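/- Let $H$ be a separable right quaternionic Hilbert space, i.e. a separable complete right $\mathbb{H}$-module with an $\mathbb{H}$-valued inner product $\langle\cdot|\cdot\rangle$ that is right $\mathbb{H}$-linear in the second variable, satisfies $\langle u|v\rangle=\overline{\langle v|u\rangle}$, and induces the norm by $\|u\|^2=\langle u|u\rangle$. Let $A\in\mathcal{B}(H)$ be a bounded right $\mathbb{H}$-linear operator with null space $N(A)$ and range $R(A)$, and let $|A|$ be the unique positive operator with $|A|^2=A^*A$. A partial isometry is an operator $U\in\mathcal{B}(H)$ with $\|Ux\|=\|x\|$ for all $x\in N(U)^\perp$. There is a unique partial isometry $U_0\in\mathcal{B}(H)$ with $A=U_0|A|$ and $N(U_0)=N(A)$ (the polar factor of $A$). Moreover, the decomposition is unique without the null space condition exactly in the following case: every partial isometry $U\in\mathcal{B}(H)$ with $A=U|A|$ satisfies $U=U_0$ if and only if $N(A)=\{0\}$ or $R(A)^\perp=\{0\}$. -/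

import Mathlib

open scoped Quaternion

/-- A right quaternionic inner product space.  The right scalar multiplication `x · q` is the
action `MulOpposite.op q • x` of the opposite ring; the inner product is `ℍ`-valued, additive and
right linear in the second variable and Hermitian, and it induces the norm.  A right quaternionic
Hilbert space is such a space that is complete. -/
class RightQuaternionicInnerProductSpace (H : Type*) [NormedAddCommGroup H] [Module ℍᵐᵒᵖ H]
    extends Inner ℍ H where
  qinner_add_right : ∀ x y z : H, inner x (y + z) = inner x y + inner x z
  qinner_smul_right : ∀ (x y : H) (q : ℍ), inner x (MulOpposite.op q • y) = inner x y * q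
  star_qinner : ∀ x y : H, star (inner y x) = inner x y
  qinner_self_eq_norm_sq : ∀ x : H, inner x x = ((‖x‖ ^ 2 : ℝ) : ℍ)

namespace Quaternionic

variable {H : Type*} [NormedAddCommGroup H] [Module ℍᵐᵒᵖ H]
  [RightQuaternionicInnerProductSpace H]

open RightQuaternionicInnerProductSpace

lemma qinner_add_left (x y z : H) : inner ℍ (x + y) z = inner ℍ x z + inner ℍ y z := by
  rw [← star_qinner, qinner_add_right, star_add, star_qinner, star_qinner]

lemma qinner_smul_left (x y : H) (q : ℍ) :
    inner ℍ (MulOpposite.op q • x) y = star q * inner ℍ x y := by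
  rw [← star_qinner, qinner_smul_right, star_mul, star_qinner]

lemma qinner_zero_right (x : H) : inner ℍ x (0 : H) = 0 := by
  have h := qinner_add_right x (0 : H) 0
  simpa using h

/-- The orthogonal complement `K^⊥` of a (right) subspace `K`. -/
def orthogonal (K : Submodule ℍᵐᵒᵖ H) : Submodule ℍᵐᵒᵖ H where
  carrier := {x | ∀ y ∈ K, inner ℍ y x = 0}
  add_mem' := fun {a b} ha hb y hy => by rw [qinner_add_right, ha y hy, hb y hy, add_zero]
  zero_mem' := fun y _ => qinner_zero_right y
  smul_mem' := fun c x hx y hy => by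
    have h := qinner_smul_right y x c.unop
    rw [MulOpposite.op_unop, hx y hy, zero_mul] at h
    exact h

/-! ### The underlying complex Hilbert space

Auxiliary: restricting the right action to `ℂ = ℝ + ℝ i ⊆ ℍ` and taking the `ℂ`-component of the
inner product makes `H` a complex inner product space with the same norm.  This is only used to
prove that adjoints and positive square roots exist. -/

section Complexification

/-- The embedding of `ℂ` in the opposite ring of `ℍ`. -/
noncomputable def complexToOp : ℂ →+* ℍᵐᵒᵖ :=
  (Quaternion.ofComplex : ℂ →ₐ[ℝ] ℍ).toRingHom.toOpposite fun x y => by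
    change _ * _ = _ * _
    rw [← map_mul, ← map_mul, mul_comm]

/-- The `ℂ`-component of a quaternion. -/
def complexPart (q : ℍ) : ℂ := ⟨q.re, q.imI⟩

lemma norm_op_smul (x : H) (q : ℍ) : ‖MulOpposite.op q • x‖ = ‖q‖ * ‖x‖ := by
  have h := qinner_self_eq_norm_sq (MulOpposite.op q • x)
  rw [qinner_smul_left, qinner_smul_right, qinner_self_eq_norm_sq, ← mul_assoc,
    ← (Quaternion.coe_commutes (‖x‖ ^ 2) (star q)), mul_assoc, Quaternion.star_mul_self,
    ← Quaternion.coe_mul, Quaternion.coe_inj, Quaternion.normSq_eq_norm_mul_self] at h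
  have h2 : ‖MulOpposite.op q • x‖ ^ 2 = (‖q‖ * ‖x‖) ^ 2 := by rw [← h]; ring
  exact (pow_left_inj₀ (norm_nonneg _) (by positivity) two_ne_zero).1 h2

/-- The complex inner product space underlying a right quaternionic inner product space. -/
@[reducible] noncomputable def complexStructure : InnerProductSpace ℂ H where
  toModule := Module.compHom H complexToOp
  norm_smul_le := fun c x => by
    change ‖MulOpposite.op (c : ℍ) • x‖ ≤ _
    rw [norm_op_smul]
    refine le_of_eq (congrArg (· * ‖x‖) ?_)
    rw [← sq_eq_sq₀ (norm_nonneg _) (norm_nonneg _), sq, ← Quaternion.normSq_eq_norm_mul_self,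
      Quaternion.normSq_def', Complex.sq_norm, Complex.normSq_apply]
    simp [sq]
  inner := fun x y => complexPart (inner ℍ x y)
  norm_sq_eq_re_inner := fun x => by
    rw [qinner_self_eq_norm_sq]
    exact (Quaternion.re_coe _).symm
  conj_inner_symm := fun x y => by
    rw [← star_qinner x y]
    apply Complex.ext <;> simp [complexPart]
  add_left := fun x y z => by
    rw [qinner_add_left]
    apply Complex.ext <;> simp [complexPart]
  smul_left := fun x y c => by
    change complexPart (inner ℍ (MulOpposite.op (c : ℍ) • x) y) = _
    rw [qinner_smul_left]
    apply Complex.ext <;> simp [complexPart]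

attribute [local instance] complexStructure

lemma complex_smul_def (c : ℂ) (x : H) : c • x = MulOpposite.op (c : ℍ) • x := rfl

lemma complex_inner_def (x y : H) : inner ℂ x y = complexPart (inner ℍ x y) := rfl

/-- The unit quaternion `j`. -/
def unitJ : ℍ := ⟨0, 0, 1, 0⟩

@[simp] lemma unitJ_re : unitJ.re = 0 := rfl
@[simp] lemma unitJ_imI : unitJ.imI = 0 := rfl
@[simp] lemma unitJ_imJ : unitJ.imJ = 1 := rfl
@[simp] lemma unitJ_imK : unitJ.imK = 0 := rfl

lemma quaternion_eq (q : ℍ) :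
    q = ((⟨q.re, q.imI⟩ : ℂ) : ℍ) + ((⟨q.imJ, q.imK⟩ : ℂ) : ℍ) * unitJ := by
  ext <;> simp

lemma quaternion_ext_complexPart {p q : ℍ} (h : complexPart p = complexPart q)
    (hj : complexPart (p * unitJ) = complexPart (q * unitJ)) : p = q := by
  simp only [complexPart, Complex.mk.injEq] at h hj
  simp at hj
  ext
  exacts [h.1, h.2, hj.1, hj.2]

lemma star_unitJ_mul : star unitJ * unitJ = 1 := by ext <;> simp

lemma unitJ_mul_star : unitJ * star unitJ = 1 := by ext <;> simp

lemma complexPart_conj (q : ℍ) :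
    complexPart (unitJ * q * star unitJ) = starRingEnd ℂ (complexPart q) := by
  apply Complex.ext <;> simp [complexPart]

/-- A bounded right linear operator seen as a bounded complex linear operator. -/
noncomputable def toComplex (A : H →L[ℍᵐᵒᵖ] H) : H →L[ℂ] H where
  toFun := A
  map_add' := map_add A
  map_smul' := fun c x => A.map_smul (MulOpposite.op (c : ℍ)) x
  cont := A.cont

/-- A bounded complex linear operator commuting with the right action of `j` is right linear. -/
noncomputable def ofComplex (T : H →L[ℂ] H)
    (hT : ∀ x, T (MulOpposite.op unitJ • x) = MulOpposite.op unitJ • T x) : H →L[ℍᵐᵒᵖ] H where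
  toFun := T
  map_add' := map_add T
  map_smul' := fun q x => by
    have key : ∀ y : H, q • y = (⟨q.unop.re, q.unop.imI⟩ : ℂ) • y +
        MulOpposite.op unitJ • ((⟨q.unop.imJ, q.unop.imK⟩ : ℂ) • y) := fun y => by
      rw [complex_smul_def, complex_smul_def, smul_smul, ← MulOpposite.op_mul, ← add_smul,
        ← MulOpposite.op_add, ← quaternion_eq, MulOpposite.op_unop]
    rw [RingHom.id_apply, key x, key (T x), map_add, hT, map_smul, map_smul]
  cont := T.cont

lemma qinner_ext {x y : H} (h : ∀ z, inner ℍ x z = inner ℍ y z) : x = y :=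
  ext_inner_right ℂ fun z => by rw [complex_inner_def, complex_inner_def, h]

set_option linter.unusedSectionVars false in
lemma unitJ_smul_star_smul (x : H) :
    MulOpposite.op unitJ • MulOpposite.op (star unitJ) • x = x := by
  rw [smul_smul, ← MulOpposite.op_mul, star_unitJ_mul, MulOpposite.op_one, one_smul]

set_option linter.unusedSectionVars false in
lemma star_smul_unitJ_smul (x : H) :
    MulOpposite.op (star unitJ) • MulOpposite.op unitJ • x = x := by
  rw [smul_smul, ← MulOpposite.op_mul, unitJ_mul_star, MulOpposite.op_one, one_smul]

lemma unitJ_smul_complex_smul (c : ℂ) (x : H) :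
    MulOpposite.op unitJ • c • x = (starRingEnd ℂ c) • MulOpposite.op unitJ • x := by
  rw [complex_smul_def, complex_smul_def, smul_smul, smul_smul, ← MulOpposite.op_mul,
    ← MulOpposite.op_mul]
  congr 2
  ext <;> simp

lemma star_unitJ_smul_complex_smul (c : ℂ) (x : H) :
    MulOpposite.op (star unitJ) • c • x =
      (starRingEnd ℂ c) • MulOpposite.op (star unitJ) • x := by
  rw [complex_smul_def, complex_smul_def, smul_smul, smul_smul, ← MulOpposite.op_mul,
    ← MulOpposite.op_mul]
  congr 2
  ext <;> simp

lemma continuous_op_smul (q : ℍ) : Continuous fun x : H => MulOpposite.op q • x :=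
  AddMonoidHomClass.continuous_of_bound
    (DistribSMul.toAddMonoidHom H (MulOpposite.op q)) ‖q‖ fun x => (norm_op_smul x q).le

/-- Conjugation of a complex linear operator by the right action of `j`. -/
noncomputable def conjJ (S : H →L[ℂ] H) : H →L[ℂ] H where
  toFun x := MulOpposite.op (star unitJ) • S (MulOpposite.op unitJ • x)
  map_add' x y := by rw [smul_add, map_add, smul_add]
  map_smul' c x := by
    rw [unitJ_smul_complex_smul, map_smul, star_unitJ_smul_complex_smul, Complex.conj_conj,
      RingHom.id_apply]
  cont := (continuous_op_smul _).comp (S.cont.comp (continuous_op_smul _))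

lemma conjJ_apply (S : H →L[ℂ] H) (x : H) :
    conjJ S x = MulOpposite.op (star unitJ) • S (MulOpposite.op unitJ • x) := rfl

lemma conjJ_nonneg {S : H →L[ℂ] H} (hS : 0 ≤ S) : 0 ≤ conjJ S := by
  rw [ContinuousLinearMap.nonneg_iff_isPositive, ContinuousLinearMap.isPositive_iff_complex]
    at hS ⊢
  intro x
  have key : inner ℂ (conjJ S x) x = starRingEnd ℂ
      (inner ℂ (S (MulOpposite.op unitJ • x)) (MulOpposite.op unitJ • x)) := by
    rw [complex_inner_def, complex_inner_def, ← complexPart_conj, conjJ_apply, qinner_smul_left,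
      qinner_smul_right, star_star, mul_assoc, mul_assoc, unitJ_mul_star, mul_one]
  have h := hS (MulOpposite.op unitJ • x)
  rw [key, ← h.1]
  simpa using h.2

variable [CompleteSpace H]

lemma exists_adjoint (A : H →L[ℍᵐᵒᵖ] H) :
    ∃ B : H →L[ℍᵐᵒᵖ] H, ∀ x y : H, inner ℍ (B x) y = inner ℍ x (A y) := by
  set B := ContinuousLinearMap.adjoint (toComplex A) with hB
  have h1 : ∀ x y : H, complexPart (inner ℍ (B x) y) = complexPart (inner ℍ x (A y)) :=
    fun x y => ContinuousLinearMap.adjoint_inner_left (toComplex A) y x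
  have h2 : ∀ x y : H, inner ℍ (B x) y = inner ℍ x (A y) := fun x y => by
    refine quaternion_ext_complexPart (h1 x y) ?_
    rw [← qinner_smul_right, ← qinner_smul_right, h1, map_smul]
  refine ⟨ofComplex B fun x => qinner_ext fun z => ?_, h2⟩
  rw [h2, qinner_smul_left, qinner_smul_left, h2]

/-- The adjoint `A^*` of a bounded right linear operator: `⟨A^* x | y⟩ = ⟨x | A y⟩`. -/
noncomputable def adjoint (A : H →L[ℍᵐᵒᵖ] H) : H →L[ℍᵐᵒᵖ] H :=
  Classical.choose (exists_adjoint A)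

lemma adjoint_inner_left (A : H →L[ℍᵐᵒᵖ] H) (x y : H) :
    inner ℍ (adjoint A x) y = inner ℍ x (A y) :=
  Classical.choose_spec (exists_adjoint A) x y

lemma eq_adjoint_iff (A B : H →L[ℍᵐᵒᵖ] H) :
    B = adjoint A ↔ ∀ x y : H, inner ℍ (B x) y = inner ℍ x (A y) := by
  refine ⟨fun h => h ▸ adjoint_inner_left A, fun h => ?_⟩
  ext x
  exact qinner_ext fun z => by rw [h, adjoint_inner_left]

/-- A bounded right linear operator `T` is positive if `T = T^*` and `⟨x | T x⟩ ≥ 0` for all `x`,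
that is, `⟨x | T x⟩` is a nonnegative real number. -/
def IsPositive (T : H →L[ℍᵐᵒᵖ] H) : Prop :=
  T = adjoint T ∧ ∀ x : H, ∃ r : ℝ, 0 ≤ r ∧ inner ℍ x (T x) = (r : ℍ)

lemma isPositive_iff (T : H →L[ℍᵐᵒᵖ] H) : IsPositive T ↔ 0 ≤ toComplex T := by
  rw [ContinuousLinearMap.nonneg_iff_isPositive]
  constructor
  · rintro ⟨hT, hpos⟩
    rw [eq_adjoint_iff] at hT
    rw [ContinuousLinearMap.isPositive_iff_complex]
    intro x
    obtain ⟨r, hr, hx⟩ := hpos x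
    have : inner ℂ (toComplex T x) x = (r : ℂ) := by
      change complexPart (inner ℍ (T x) x) = _
      rw [hT, hx]
      apply Complex.ext <;> simp [complexPart]
    rw [this]
    simpa using hr
  · intro h
    have h1 : ∀ x y : H, complexPart (inner ℍ (T x) y) = complexPart (inner ℍ x (T y)) :=
      fun x y => h.1 x y
    have h2 : ∀ x y : H, inner ℍ (T x) y = inner ℍ x (T y) := fun x y => by
      refine quaternion_ext_complexPart (h1 x y) ?_
      rw [← qinner_smul_right, ← qinner_smul_right, h1, map_smul]
    refine ⟨(eq_adjoint_iff T T).2 h2, fun x => ⟨(inner ℍ x (T x)).re, ?_, ?_⟩⟩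
    · rw [← h2]
      exact h.2 x
    · rw [← Quaternion.star_eq_self, star_qinner, h2]

/-- Every operator `A^* A` has a unique positive square root. -/
theorem existsUnique_modulus (A : H →L[ℍᵐᵒᵖ] H) :
    ∃! P : H →L[ℍᵐᵒᵖ] H, IsPositive P ∧ P ∘L P = adjoint A ∘L A := by
  set B : H →L[ℍᵐᵒᵖ] H := adjoint A ∘L A with hBdef
  have hB : 0 ≤ toComplex B := by
    rw [← isPositive_iff, IsPositive, eq_adjoint_iff]
    refine ⟨fun x y => ?_, fun x => ⟨‖A x‖ ^ 2, by positivity, ?_⟩⟩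
    · rw [hBdef, ContinuousLinearMap.comp_apply, ContinuousLinearMap.comp_apply,
        adjoint_inner_left, ← star_qinner x, adjoint_inner_left, star_qinner]
    · rw [hBdef, ContinuousLinearMap.comp_apply, ← star_qinner, adjoint_inner_left, star_qinner,
        qinner_self_eq_norm_sq]
  set S := CFC.sqrt (toComplex B) with hSdef
  have hS : 0 ≤ S := CFC.sqrt_nonneg _
  have hSS : ∀ x, S (S x) = B x := fun x =>
    DFunLike.congr_fun (CFC.sqrt_mul_sqrt_self (toComplex B) hB) x
  have hconj : S = conjJ S := by
    refine CFC.sqrt_unique ?_ (conjJ_nonneg hS)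
    ext x
    change conjJ S (conjJ S x) = B x
    rw [conjJ_apply, conjJ_apply, unitJ_smul_star_smul, hSS, map_smul, star_smul_unitJ_smul]
  have hSJ : ∀ x, S (MulOpposite.op unitJ • x) = MulOpposite.op unitJ • S x := fun x => by
    conv_rhs => rw [hconj, conjJ_apply, unitJ_smul_star_smul]
  refine ⟨ofComplex S hSJ, ⟨(isPositive_iff _).2 hS, ?_⟩, ?_⟩
  · ext x
    exact hSS x
  · rintro P ⟨hP, hPP⟩
    have : S = toComplex P := by
      refine CFC.sqrt_unique ?_ ((isPositive_iff P).1 hP)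
      ext x
      exact DFunLike.congr_fun hPP x
    ext x
    exact (DFunLike.congr_fun this x).symm

end Complexification

variable [CompleteSpace H]

/-- The modulus `|A|`: the unique positive operator whose square is `A^* A`. -/
noncomputable def modulus (A : H →L[ℍᵐᵒᵖ] H) : H →L[ℍᵐᵒᵖ] H :=
  Classical.choose (existsUnique_modulus A)

lemma modulus_spec (A : H →L[ℍᵐᵒᵖ] H) :
    IsPositive (modulus A) ∧ modulus A ∘L modulus A = adjoint A ∘L A :=
  (Classical.choose_spec (existsUnique_modulus A)).1

/-- A partial isometry: a bounded right linear operator that is isometric on the orthogonal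
complement of its null space. -/
def IsPartialIsometry (U : H →L[ℍᵐᵒᵖ] H) : Prop :=
  ∀ x ∈ orthogonal U.ker, ‖U x‖ = ‖x‖

/-- `U₀` is the polar factor of `A`: a partial isometry with `A = U₀ |A|` and `N(U₀) = N(A)`. -/
def IsPolarFactor (A U₀ : H →L[ℍᵐᵒᵖ] H) : Prop :=
  IsPartialIsometry U₀ ∧ A = U₀ ∘L modulus A ∧ U₀.ker = A.ker

end Quaternionic

/-! Since `‖|A|x‖ = ‖Ax‖`, the map `|A|x ↦ Ax` is well defined and isometric. With the value zero on
`N(A)`, it extends by continuity from the dense subspace `R(|A|) + N(A)`, because the two summands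
are orthogonal (`exists_polarFactor`). This is done over `ℂ`. The result commutes with the right
action of `j` because its conjugate by `j` agrees with it on both summands, so it is quaternionic
linear. The same density gives uniqueness: `U` is determined by `U|A|` and its values on `N(A)`. The
criterion is therefore about whether `U` must vanish on `N(A)`. Given unit vectors `u ∈ N(A)` and `v
∈ R(A)^⊥`, the operator `U₀ + v⟨u|·⟩` is a second solution. If `R(A)` is dense, `U` preserves norms
on `R(|A|)`, which forces `R(|A|) ⊆ N(U)^⊥`. Hence `U` sends `N(A)` into `R(A)^⊥ = {0}`. -/

section ComplexHilbert

/-! ### Self-adjoint operators and polar factors over `ℂ` -/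

variable {E F : Type*} [NormedAddCommGroup E] [InnerProductSpace ℂ E] [CompleteSpace E]

lemma ContinuousLinearMap.inner_apply_of_eq_adjoint {P : E →L[ℂ] E}
    (hP : P = ContinuousLinearMap.adjoint P) (x y : E) : inner ℂ (P x) y = inner ℂ x (P y) := by
  conv_lhs => rw [hP]
  exact ContinuousLinearMap.adjoint_inner_left P y x

/-- A vector orthogonal to the range and to the kernel of a self-adjoint operator vanishes. -/
lemma ContinuousLinearMap.eq_zero_of_inner_range_of_inner_ker {P : E →L[ℂ] E}
    (hP : P = ContinuousLinearMap.adjoint P) {y : E} (h₁ : ∀ x, inner ℂ (P x) y = 0)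
    (h₂ : ∀ n, P n = 0 → inner ℂ n y = 0) : y = 0 := by
  -- Orthogonality to the range puts `y` itself in the kernel, so `h₂` may be tested at `n = y`.
  refine inner_self_eq_zero.1 (h₂ y (ext_inner_left ℂ fun x => ?_))
  rw [← inner_apply_of_eq_adjoint hP, h₁, inner_zero_right]

/-- The range and the kernel of a self-adjoint operator span a dense subspace. -/
lemma ContinuousLinearMap.denseRange_coprod_ker {P : E →L[ℂ] E}
    (hP : P = ContinuousLinearMap.adjoint P) :
    DenseRange (P.toLinearMap.coprod P.ker.subtype) := by
  have h : (LinearMap.range (P.toLinearMap.coprod P.ker.subtype))ᗮ = ⊥ := by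
    rw [Submodule.eq_bot_iff]
    intro y hy
    rw [Submodule.mem_orthogonal] at hy
    refine eq_zero_of_inner_range_of_inner_ker hP (fun x => hy _ ⟨(x, 0), by simp⟩)
      fun n hn => hy _ ⟨(0, ⟨n, hn⟩), by simp⟩
  rw [← Submodule.topologicalClosure_eq_top_iff] at h
  rw [DenseRange, ← LinearMap.coe_range]
  exact Submodule.dense_iff_topologicalClosure_eq_top.2 h

/-- An operator vanishing on the range and on the kernel of a self-adjoint operator vanishes. -/
lemma ContinuousLinearMap.eq_of_eqOn_range_of_eqOn_ker [NormedAddCommGroup F] [NormedSpace ℂ F]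
    {P : E →L[ℂ] E} (hP : P = ContinuousLinearMap.adjoint P) {S T : E →L[ℂ] F}
    (h₁ : ∀ x, S (P x) = T (P x)) (h₂ : ∀ n, P n = 0 → S n = T n) : S = T := by
  refine DFunLike.coe_injective
    ((denseRange_coprod_ker hP).equalizer S.continuous T.continuous (funext ?_))
  rintro ⟨x, n, hn⟩
  simp [h₁, h₂ n hn]

/-- Pythagoras for the orthogonal range and kernel; this is the bound that permits extension by
continuity. -/
lemma ContinuousLinearMap.norm_apply_le_norm_apply_add {P : E →L[ℂ] E}
    (hP : P = ContinuousLinearMap.adjoint P) (x : E) {n : E} (hn : P n = 0) :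
    ‖P x‖ ≤ ‖P x + n‖ := by
  have h : inner ℂ (P x) n = 0 := by rw [inner_apply_of_eq_adjoint hP, hn, inner_zero_right]
  have h2 := norm_add_sq_eq_norm_sq_add_norm_sq_of_inner_eq_zero _ _ h
  nlinarith [norm_nonneg (P x), norm_nonneg (P x + n), norm_nonneg n]

/-- An operator that is isometric on the range of the self-adjoint operator `P` is isometric on
the orthogonal complement of the kernel of `P`. -/
lemma ContinuousLinearMap.norm_apply_of_mem_orthogonal_ker {P U : E →L[ℂ] E}
    (hP : P = ContinuousLinearMap.adjoint P) (hU : ∀ x, ‖U (P x)‖ = ‖P x‖) {x : E}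
    (hx : x ∈ P.kerᗮ) : ‖U x‖ = ‖x‖ := by
  -- Now `x` lies in the closure of the range of `P`, and being norm-preserved is a closed
  -- condition.
  rw [ContinuousLinearMap.orthogonal_ker, ← hP] at hx
  have hcl : IsClosed {x : E | ‖U x‖ = ‖x‖} := isClosed_eq (by fun_prop) (by fun_prop)
  refine closure_minimal ?_ hcl hx
  rintro _ ⟨z, rfl⟩
  exact hU z

/-- The polar factor of `A`, given a self-adjoint `P` with `‖P x‖ = ‖A x‖`. -/
lemma ContinuousLinearMap.exists_polarFactor {A P : E →L[ℂ] E}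
    (hP : P = ContinuousLinearMap.adjoint P) (hA : ∀ x, ‖P x‖ = ‖A x‖) :
    ∃ U : E →L[ℂ] E, (∀ x, U (P x) = A x) ∧ ∀ x, U x = 0 ↔ P x = 0 := by
  -- The map `e` need not be injective; the norm bound of `f` against `e` is what lets `f` factor
  -- through it.
  set e := P.toLinearMap.coprod P.ker.subtype with he
  set f : E × P.ker →ₗ[ℂ] E := A.toLinearMap ∘ₗ LinearMap.fst ℂ E P.ker with hf
  have hfe : ∀ z, f.extendOfNorm e (e z) = f z :=
    LinearMap.extendOfNorm_eq (denseRange_coprod_ker hP) ⟨1, fun z => by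
      simpa [he, hf, ← hA] using norm_apply_le_norm_apply_add hP z.1 z.2.2⟩
  set U := f.extendOfNorm e with hU
  have hUP : ∀ x, U (P x) = A x := fun x => by simpa [he, hf] using hfe (x, 0)
  have hUn : ∀ n, P n = 0 → U n = 0 := fun n hn => by simpa [he, hf] using hfe (0, ⟨n, hn⟩)
  refine ⟨U, hUP, fun x => ⟨fun hx => ?_, hUn x⟩⟩
  obtain ⟨n, hn, a, ha, rfl⟩ := P.ker.exists_add_mem_mem_orthogonal x
  have h := norm_apply_of_mem_orthogonal_ker (U := U) hP (fun z => by rw [hUP, hA]) ha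
  rw [map_add, hUn n hn, zero_add] at hx
  rw [hx, norm_zero, eq_comm, norm_eq_zero] at h
  rw [h, add_zero]
  exact hn

/-- If the range of `U ∘ P` is dense and `U` is a partial isometry that is isometric on the range
of the self-adjoint operator `P`, then `U` vanishes on the kernel of `P`. -/
lemma ContinuousLinearMap.apply_eq_zero_of_isometric_on_orthogonal_ker {P U : E →L[ℂ] E}
    (hP : P = ContinuousLinearMap.adjoint P) (hUiso : ∀ x ∈ U.kerᗮ, ‖U x‖ = ‖x‖)
    (hUP : ∀ x, ‖U (P x)‖ = ‖P x‖) (hdense : ∀ y, (∀ x, inner ℂ (U (P x)) y = 0) → y = 0)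
    {n : E} (hn : P n = 0) : U n = 0 := by
  -- Writing `P x = a + b` with `a ∈ N(U)`, `b ∈ N(U)^⊥`, one has `‖P x‖ = ‖U b‖ = ‖b‖`, and
  -- Pythagoras forces `a = 0`.
  have hrange : ∀ x, P x ∈ U.kerᗮ := fun x => by
    obtain ⟨a, ha, b, hb, hab⟩ := U.ker.exists_add_mem_mem_orthogonal (P x)
    have h1 := norm_add_sq_eq_norm_sq_add_norm_sq_of_inner_eq_zero a b
      ((Submodule.mem_orthogonal _ _).1 hb a ha)
    have h2 := hUP x
    have ha' : U a = 0 := ha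
    rw [hab, map_add, ha', zero_add, hUiso b hb] at h2
    rw [← h2] at h1
    have h3 : a = 0 := by
      rw [← norm_eq_zero]
      nlinarith
    rwa [hab, h3, zero_add]
  let V : U.kerᗮ →ₗᵢ[ℂ] E :=
    { toLinearMap := U.toLinearMap ∘ₗ U.kerᗮ.subtype
      norm_map' := fun x => hUiso x x.2 }
  have hinner : ∀ x ∈ U.kerᗮ, ∀ y ∈ U.kerᗮ, inner ℂ (U x) (U y) = inner ℂ x y :=
    fun x hx y hy => V.inner_map_map ⟨x, hx⟩ ⟨y, hy⟩
  obtain ⟨a, ha, b, hb, rfl⟩ := U.ker.exists_add_mem_mem_orthogonal n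
  have ha' : U a = 0 := ha
  rw [map_add, ha', zero_add]
  -- `⟨U P x, U b⟩ = ⟨P x, b⟩ = ⟨P x, a + b⟩ = 0`, as `P x` is orthogonal to both `a` and `N(P)`.
  refine hdense _ fun x => ?_
  rw [hinner _ (hrange x) _ hb]
  have h1 : inner ℂ (P x) (a + b) = 0 := by
    rw [inner_apply_of_eq_adjoint hP, hn, inner_zero_right]
  rwa [inner_add_right, (Submodule.mem_orthogonal' _ _).1 (hrange x) a ha, zero_add] at h1

end ComplexHilbert

/-! ### Quaternionic versus complex orthogonality -/

namespace Quaternionic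

open RightQuaternionicInnerProductSpace

variable {H : Type*} [NormedAddCommGroup H] [Module ℍᵐᵒᵖ H]
  [RightQuaternionicInnerProductSpace H]

attribute [local instance] complexStructure

lemma inner_eq_zero_comm {x y : H} : inner ℍ x y = 0 ↔ inner ℍ y x = 0 := by
  rw [← star_qinner, star_eq_zero]

lemma complex_inner_eq_zero {x y : H} (h : inner ℍ x y = 0) : inner ℂ x y = 0 := by
  rw [complex_inner_def, h]
  rfl

/-- A quaternion `p` is determined by the `ℂ`-components of `p` and `p j`, so only `q = 1` and `q =
j` matter. -/
lemma inner_eq_zero_of_complex {x y : H} (h : ∀ q : ℍ, inner ℂ x (MulOpposite.op q • y) = 0) :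
    inner ℍ x y = 0 := by
  refine quaternion_ext_complexPart ?_ ?_
  · have h1 := h 1
    rw [MulOpposite.op_one, one_smul, complex_inner_def] at h1
    rw [h1]
    rfl
  · have h1 := h unitJ
    rw [complex_inner_def, qinner_smul_right] at h1
    rw [h1, zero_mul]
    rfl

/-- The right linear and the complex orthogonal complements of a right subspace agree. -/
lemma mem_orthogonal_iff_mem_complex_orthogonal {K : Submodule ℍᵐᵒᵖ H} {L : Submodule ℂ H}
    (hKL : ∀ x, x ∈ K ↔ x ∈ L) (x : H) : x ∈ orthogonal K ↔ x ∈ Lᗮ := by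
  rw [Submodule.mem_orthogonal]
  refine ⟨fun h y hy => complex_inner_eq_zero (h y ((hKL y).2 hy)), fun h y hy => ?_⟩
  refine inner_eq_zero_comm.1 (inner_eq_zero_of_complex fun q => ?_)
  exact inner_eq_zero_symm.1 (h _ ((hKL _).1 (K.smul_mem _ hy)))

lemma norm_add_sq_of_inner_eq_zero {x y : H} (h : inner ℍ x y = 0) :
    ‖x + y‖ ^ 2 = ‖x‖ ^ 2 + ‖y‖ ^ 2 := by
  simp only [sq]
  exact norm_add_sq_eq_norm_sq_add_norm_sq_of_inner_eq_zero (𝕜 := ℂ) x y (complex_inner_eq_zero h)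

/-- Rotating and scaling `x` by `q = ⟨x|y⟩` makes the inner product the real number `‖q‖²`; complex
Cauchy–Schwarz then applies, and one factor `‖q‖` cancels. -/
lemma norm_qinner_le (x y : H) : ‖inner ℍ x y‖ ≤ ‖x‖ * ‖y‖ := by
  set q : ℍ := inner ℍ x y with hq
  have h1 : inner ℂ (MulOpposite.op q • x) y = ((‖q‖ * ‖q‖ : ℝ) : ℂ) := by
    rw [complex_inner_def, qinner_smul_left, ← hq, Quaternion.star_mul_self,
      Quaternion.normSq_eq_norm_mul_self]
    rfl
  have h2 := norm_inner_le_norm (𝕜 := ℂ) (MulOpposite.op q • x) y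
  rw [h1, norm_op_smul, Complex.norm_real, Real.norm_of_nonneg (by positivity), mul_assoc] at h2
  rcases (norm_nonneg q).eq_or_lt with h | h
  · rw [← h]
    positivity
  · exact le_of_mul_le_mul_left h2 h

/-- The operator `x ↦ v ⟨u | x⟩`. -/
noncomputable def rankOne (v u : H) : H →L[ℍᵐᵒᵖ] H where
  toFun x := MulOpposite.op (inner ℍ u x) • v
  map_add' x y := by rw [qinner_add_right, MulOpposite.op_add, add_smul]
  map_smul' q x := by
    have h := qinner_smul_right u x q.unop
    rw [MulOpposite.op_unop] at h
    rw [h, MulOpposite.op_mul, MulOpposite.op_unop, mul_smul, RingHom.id_apply]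
  cont := AddMonoidHomClass.continuous_of_bound
    (AddMonoidHom.mk' (fun x => MulOpposite.op (inner ℍ u x) • v) fun x y => by
      rw [qinner_add_right, MulOpposite.op_add, add_smul]) (‖u‖ * ‖v‖) fun x => by
    change ‖MulOpposite.op (inner ℍ u x) • v‖ ≤ _
    rw [norm_op_smul, mul_right_comm]
    gcongr
    exact norm_qinner_le u x

lemma rankOne_apply (v u x : H) : rankOne v u x = MulOpposite.op (inner ℍ u x) • v := rfl

lemma exists_norm_eq_one_mem {K : Submodule ℍᵐᵒᵖ H} (hK : K ≠ ⊥) : ∃ u ∈ K, ‖u‖ = 1 := by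
  obtain ⟨u, hu, hu0⟩ := K.ne_bot_iff.1 hK
  refine ⟨MulOpposite.op ((‖u‖⁻¹ : ℝ) : ℍ) • u, K.smul_mem _ hu, ?_⟩
  rw [norm_op_smul, Quaternion.norm_coe, norm_inv, norm_norm,
    inv_mul_cancel₀ (norm_ne_zero_iff.2 hu0)]

lemma inner_self_of_norm_eq_one {u : H} (hu : ‖u‖ = 1) : inner ℍ u u = 1 := by
  rw [qinner_self_eq_norm_sq, hu, one_pow, Quaternion.coe_one]

/-! ### The modulus and the quaternionic polar factor -/

variable [CompleteSpace H]

lemma toComplex_modulus_eq_adjoint (A : H →L[ℍᵐᵒᵖ] H) :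
    toComplex (modulus A) = ContinuousLinearMap.adjoint (toComplex (modulus A)) := by
  have h := (isPositive_iff _).1 (modulus_spec A).1
  rw [ContinuousLinearMap.nonneg_iff_isPositive] at h
  exact h.isSelfAdjoint.adjoint_eq.symm

/-- `⟨|A|x, |A|x⟩ = ⟨|A|²x, x⟩ = ⟨A^*A x, x⟩ = ⟨Ax, Ax⟩`. -/
lemma norm_modulus_apply (A : H →L[ℍᵐᵒᵖ] H) (x : H) : ‖modulus A x‖ = ‖A x‖ := by
  obtain ⟨⟨hP, -⟩, hPP⟩ := modulus_spec A
  have h1 : inner ℍ (modulus A x) (modulus A x) = inner ℍ (A x) (A x) := by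
    have h2 := adjoint_inner_left (modulus A) (modulus A x) x
    rw [← hP] at h2
    rw [← h2, ← adjoint_inner_left A]
    exact congrArg (inner ℍ · x) (DFunLike.congr_fun hPP x)
  rw [qinner_self_eq_norm_sq, qinner_self_eq_norm_sq, Quaternion.coe_inj] at h1
  exact (pow_left_inj₀ (norm_nonneg _) (norm_nonneg _) two_ne_zero).1 h1

lemma modulus_apply_eq_zero {A : H →L[ℍᵐᵒᵖ] H} {x : H} : modulus A x = 0 ↔ A x = 0 := by
  rw [← norm_eq_zero, norm_modulus_apply, norm_eq_zero]

/-- An operator is determined by its composition with `|A|` and its values on `N(A)`. -/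
lemma eq_of_comp_modulus_eq {A S T : H →L[ℍᵐᵒᵖ] H} (h₁ : S ∘L modulus A = T ∘L modulus A)
    (h₂ : ∀ n, A n = 0 → S n = T n) : S = T := by
  have h : toComplex S = toComplex T :=
    ContinuousLinearMap.eq_of_eqOn_range_of_eqOn_ker (toComplex_modulus_eq_adjoint A)
      (fun x => DFunLike.congr_fun h₁ x) fun n hn => h₂ n (modulus_apply_eq_zero.1 hn)
  ext x
  exact DFunLike.congr_fun h x

/-- An operator `U` with `A = U |A|` is isometric on `N(A)^⊥`. -/
lemma norm_apply_of_mem_orthogonal_ker {A U : H →L[ℍᵐᵒᵖ] H} (hU : A = U ∘L modulus A) {x : H}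
    (hx : x ∈ orthogonal A.ker) : ‖U x‖ = ‖x‖ := by
  refine ContinuousLinearMap.norm_apply_of_mem_orthogonal_ker (U := toComplex U)
    (toComplex_modulus_eq_adjoint A) (fun z => ?_)
    ((mem_orthogonal_iff_mem_complex_orthogonal (fun n => ?_) x).1 hx)
  · change ‖U (modulus A z)‖ = ‖modulus A z‖
    rw [norm_modulus_apply]
    exact congrArg norm (DFunLike.congr_fun hU z).symm
  · exact modulus_apply_eq_zero.symm

theorem exists_isPolarFactor (A : H →L[ℍᵐᵒᵖ] H) : ∃ U, IsPolarFactor A U := by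
  have hP := toComplex_modulus_eq_adjoint A
  obtain ⟨U, hUP, hUker⟩ := ContinuousLinearMap.exists_polarFactor (A := toComplex A) hP
    (norm_modulus_apply A)
  have hconj : U = conjJ U := by
    refine ContinuousLinearMap.eq_of_eqOn_range_of_eqOn_ker hP (fun x => ?_) fun n hn => ?_
    · rw [hUP, conjJ_apply]
      have h : U (modulus A (MulOpposite.op unitJ • x)) = A (MulOpposite.op unitJ • x) :=
        hUP (MulOpposite.op unitJ • x)
      rw [(modulus A).map_smul, A.map_smul] at h
      change A x = MulOpposite.op (star unitJ) • U (MulOpposite.op unitJ • modulus A x)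
      rw [h, star_smul_unitJ_smul]
    · have h : toComplex (modulus A) (MulOpposite.op unitJ • n) = 0 := by
        change modulus A _ = 0
        rw [map_smul]
        exact (congrArg _ hn).trans (smul_zero _)
      rw [conjJ_apply, (hUker n).2 hn, (hUker _).2 h, smul_zero]
  have hUJ : ∀ x, U (MulOpposite.op unitJ • x) = MulOpposite.op unitJ • U x := fun x => by
    conv_rhs => rw [hconj, conjJ_apply, unitJ_smul_star_smul]
  have hcomp : A = ofComplex U hUJ ∘L modulus A := by
    ext x
    exact (hUP x).symm
  have hker : (ofComplex U hUJ).ker = A.ker := by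
    ext x
    exact (hUker x).trans modulus_apply_eq_zero
  exact ⟨ofComplex U hUJ, fun x hx => norm_apply_of_mem_orthogonal_ker hcomp (hker ▸ hx),
    hcomp, hker⟩

lemma exists_add_mem_ker_mem_orthogonal (A : H →L[ℍᵐᵒᵖ] H) (x : H) :
    ∃ n ∈ A.ker, ∃ a ∈ orthogonal A.ker, x = n + a := by
  obtain ⟨n, hn, a, ha, h⟩ := (toComplex A).ker.exists_add_mem_mem_orthogonal x
  exact ⟨n, hn, a, (mem_orthogonal_iff_mem_complex_orthogonal (fun _ => Iff.rfl) a).2 ha, h⟩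

/-- The range of an operator `U` with `A = U |A|` and `N(A) ≤ N(U)` is orthogonal to
`R(A)^⊥`. -/
lemma inner_apply_eq_zero_of_mem_orthogonal_range {A U : H →L[ℍᵐᵒᵖ] H}
    (hU : A = U ∘L modulus A) (hker : ∀ n, A n = 0 → U n = 0) {v : H}
    (hv : v ∈ orthogonal A.range) (x : H) : inner ℍ v (U x) = 0 := by
  -- Tested on `R(|A|)`, where `U|A|z = Az` is orthogonal to `v`, and on `N(A)`, where `U` vanishes.
  have h : adjoint U v = 0 := by
    refine ContinuousLinearMap.eq_zero_of_inner_range_of_inner_ker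
      (toComplex_modulus_eq_adjoint A) (fun z => complex_inner_eq_zero ?_)
      fun n hn => complex_inner_eq_zero ?_
    · rw [inner_eq_zero_comm, adjoint_inner_left, inner_eq_zero_comm]
      exact hv _ ⟨z, DFunLike.congr_fun hU z⟩
    · rw [inner_eq_zero_comm, adjoint_inner_left, hker n (modulus_apply_eq_zero.1 hn),
        qinner_zero_right]
  rw [← adjoint_inner_left, h, inner_eq_zero_comm, qinner_zero_right]

/-! ### Partial isometries `U` with `A = U|A|` -/

/-- Adding a rank one isometry from `N(A)` to `R(A)^⊥` to the polar factor of `A` gives a partial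
isometry. -/
lemma IsPolarFactor.isPartialIsometry_add_rankOne {A U : H →L[ℍᵐᵒᵖ] H} (hU : IsPolarFactor A U)
    {u v : H} (hu : u ∈ A.ker) (hu1 : ‖u‖ = 1) (hv : v ∈ orthogonal A.range) (hv1 : ‖v‖ = 1) :
    IsPartialIsometry (U + rankOne v u) := by
  obtain ⟨-, hcomp, hker⟩ := hU
  have hUn : ∀ n, A n = 0 → U n = 0 := fun n hn => hker.ge hn
  intro x hx
  obtain ⟨n, hn, a, ha, rfl⟩ := exists_add_mem_ker_mem_orthogonal A x
  set q : ℍ := inner ℍ u n with hq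
  -- The part `m` of `n` orthogonal to `u` is killed by the perturbed operator; as `n + a` is
  -- orthogonal to that kernel, `⟨m|m⟩ = 0`.
  obtain ⟨m, hm⟩ : ∃ m, m = n - MulOpposite.op q • u := ⟨_, rfl⟩
  have hnm : n = m + MulOpposite.op q • u := by rw [hm, sub_add_cancel]
  have hmA : m ∈ A.ker := hm ▸ sub_mem hn (A.ker.smul_mem _ hu)
  have hum : inner ℍ u m = 0 := by
    have h := hq
    rw [hnm, qinner_add_right, qinner_smul_right, inner_self_of_norm_eq_one hu1, one_mul] at h
    simpa using h
  have hmU : m ∈ (U + rankOne v u).ker := by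
    change U m + rankOne v u m = 0
    rw [hUn m hmA, rankOne_apply, hum, MulOpposite.op_zero, zero_smul, zero_add]
  have hm0 : m = 0 := by
    have h := hx m hmU
    rw [qinner_add_right, ha m hmA, add_zero, hnm, qinner_add_right, qinner_smul_right,
      inner_eq_zero_comm.1 hum, zero_mul, add_zero, qinner_self_eq_norm_sq] at h
    simpa using Quaternion.coe_inj.1 (h.trans Quaternion.coe_zero.symm)
  have hua : inner ℍ u a = 0 := ha u hu
  have happ : (U + rankOne v u) (n + a) = U a + MulOpposite.op q • v := by
    change U (n + a) + rankOne v u (n + a) = _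
    rw [map_add, hUn n hn, zero_add, rankOne_apply, qinner_add_right, hua, add_zero]
  have h1 : ‖U a + MulOpposite.op q • v‖ ^ 2 = ‖U a‖ ^ 2 + ‖MulOpposite.op q • v‖ ^ 2 := by
    refine norm_add_sq_of_inner_eq_zero ?_
    rw [qinner_smul_right, inner_eq_zero_comm.1
      (inner_apply_eq_zero_of_mem_orthogonal_range hcomp hUn hv a), zero_mul]
  have h2 : ‖n + a‖ ^ 2 = ‖n‖ ^ 2 + ‖a‖ ^ 2 := norm_add_sq_of_inner_eq_zero (ha n hn)
  have h3 : ‖n‖ = ‖q‖ := by rw [hnm, hm0, zero_add, norm_op_smul, hu1, mul_one]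
  refine (pow_left_inj₀ (norm_nonneg _) (norm_nonneg _) two_ne_zero).1 ?_
  rw [happ, h1, h2, norm_apply_of_mem_orthogonal_ker hcomp ha, norm_op_smul, hv1, mul_one, h3,
    add_comm]

/-- `|A|` has range orthogonal to `N(A)`. -/
lemma inner_modulus_apply_eq_zero {A : H →L[ℍᵐᵒᵖ] H} {u : H} (hu : u ∈ A.ker) (x : H) :
    inner ℍ u (modulus A x) = 0 := by
  have h := adjoint_inner_left (modulus A) u x
  rw [← (modulus_spec A).1.1, modulus_apply_eq_zero.2 hu] at h
  rw [← h, inner_eq_zero_comm, qinner_zero_right]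

/-- If `R(A)` is dense, a partial isometry `U` with `A = U |A|` vanishes on `N(A)`. -/
lemma IsPartialIsometry.apply_eq_zero_of_orthogonal_range_eq_bot {A U : H →L[ℍᵐᵒᵖ] H}
    (hU : IsPartialIsometry U) (hcomp : A = U ∘L modulus A) (hA : orthogonal A.range = ⊥) {n : H}
    (hn : A n = 0) : U n = 0 := by
  refine ContinuousLinearMap.apply_eq_zero_of_isometric_on_orthogonal_ker (U := toComplex U)
    (toComplex_modulus_eq_adjoint A) (fun x hx => hU x ?_) (fun x => ?_) (fun y hy => ?_)
    (modulus_apply_eq_zero.2 hn)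
  · exact (mem_orthogonal_iff_mem_complex_orthogonal (fun _ => Iff.rfl) x).2 hx
  · change ‖U (modulus A x)‖ = ‖modulus A x‖
    rw [norm_modulus_apply]
    exact congrArg norm (DFunLike.congr_fun hcomp x).symm
  · rw [← Submodule.mem_bot ℍᵐᵒᵖ, ← hA, mem_orthogonal_iff_mem_complex_orthogonal
      (L := (toComplex A).range) (fun _ => Iff.rfl), Submodule.mem_orthogonal]
    rintro _ ⟨x, rfl⟩
    have h : toComplex A x = toComplex U (toComplex (modulus A) x) := DFunLike.congr_fun hcomp x
    exact (congrArg (inner ℂ · y) h).trans (hy x)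

end Quaternionic

open Quaternionic in
theorem mainTheorem3 {H : Type*} [NormedAddCommGroup H] [Module ℍᵐᵒᵖ H]
    [RightQuaternionicInnerProductSpace H] [CompleteSpace H] [TopologicalSpace.SeparableSpace H]
    (A : H →L[ℍᵐᵒᵖ] H) :
    (∃! U₀ : H →L[ℍᵐᵒᵖ] H, IsPolarFactor A U₀) ∧
      ∀ U₀ : H →L[ℍᵐᵒᵖ] H, IsPolarFactor A U₀ →
        ((∀ U : H →L[ℍᵐᵒᵖ] H, IsPartialIsometry U → A = U ∘L modulus A → U = U₀) ↔
          A.ker = ⊥ ∨ orthogonal A.range = ⊥) := by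
  have huniq : ∀ U₀ : H →L[ℍᵐᵒᵖ] H, IsPolarFactor A U₀ → ∀ U : H →L[ℍᵐᵒᵖ] H,
      A = U ∘L modulus A → (∀ n, A n = 0 → U n = 0) → U = U₀ :=
    fun U₀ h₀ U h hn => eq_of_comp_modulus_eq (h.symm.trans h₀.2.1) fun n hAn =>
      (hn n hAn).trans (show U₀ n = 0 from h₀.2.2.ge hAn).symm
  refine ⟨?_, fun U₀ h₀ => ⟨fun h => ?_, ?_⟩⟩
  · obtain ⟨U₀, h₀⟩ := exists_isPolarFactor A
    exact ⟨U₀, h₀, fun U hU => huniq U₀ h₀ U hU.2.1 fun n hn => hU.2.2.ge hn⟩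
  · by_contra! hne
    obtain ⟨u, hu, hu1⟩ := exists_norm_eq_one_mem hne.1
    obtain ⟨v, hv, hv1⟩ := exists_norm_eq_one_mem hne.2
    have hU := h (U₀ + rankOne v u) (h₀.isPartialIsometry_add_rankOne hu hu1 hv hv1) (by
      ext x
      change A x = U₀ (modulus A x) + rankOne v u (modulus A x)
      rw [rankOne_apply, inner_modulus_apply_eq_zero hu, MulOpposite.op_zero, zero_smul, add_zero]
      exact DFunLike.congr_fun h₀.2.1 x)
    -- Evaluating the perturbation at `u` returns `v`, a unit vector.
    have h1 : rankOne v u u = 0 := by rw [add_eq_left.1 hU]; rfl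
    rw [rankOne_apply, inner_self_of_norm_eq_one hu1, MulOpposite.op_one, one_smul] at h1
    rw [h1, norm_zero] at hv1
    exact zero_ne_one hv1
  · rintro (hA | hA) U hU hcomp
    · refine huniq U₀ h₀ U hcomp fun n hn => ?_
      have hn0 : n ∈ A.ker := hn
      rw [hA, Submodule.mem_bot] at hn0
      rw [hn0, map_zero]
    · exact huniq U₀ h₀ U hcomp fun n hn =>
        hU.apply_eq_zero_of_orthogonal_range_eq_bot hcomp hA hn
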